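/- For a probability distribution $\mathcal D$ on $[B]=\{1,\dots,B\}$ let $F_{\mathcal D}(t)=\Pr_{x\sim\mathcal D}[x\le t]$ (so $F_{\mathcal D}(0)=0$ and $F_{\mathcal D}(t)=1$ for $t\ge B$). An integer $m\in\{0,1,\dots,B\}$ is an $\alpha$-approximate $q$-quantile of $\mathcal D$ if $[F_{\mathcal D}(m),F_{\mathcal D}(m+1)]\cap(q-\alpha,q+\alpha)\neq\emptyset$. A sequentially interactive protocol with $n$ users consists of randomized mechanisms $\mathcal M_1,\dots,\mathcal M_n$ and an estimator $\mathcal F$: user $i$, holding $x_i\in[B]$, publishes a message $y_i=\mathcal M_i(x_i,y_1,\dots,y_{i-1})$, and the output is $\tilde m=\mathcal F(y_1,\dots,y_n)\in\{0,1,\dots,B\}$. The messages take values in an arbitrary measurable space. The protocol is $\varepsilon$-LDP if for all $i$, all fixed $y_1,\dots,y_{i-1}$, all $x,x'\in[B]$ and all measurable sets $S$ of messages, $$\Pr[\mathcal M_i(x,y_1,\dots,y_{i-1})\in S]\le e^{\varepsilon}\Pr[\mathcal M_i(x',y_1,\dots,y_{i-1})\in S].$$ **Theorem.** There is a universal constant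 $c>0$ such that the following holds. Let $B\ge4$ and $n\ge 0$ be integers, let $0<\alpha<\frac12$, $0<\varepsilon<1$ and $q\in(2\alpha,1-2\alpha)$. Suppose there is a sequentially interactive $\varepsilon$-LDP protocol with $n$ users such that, for every probability distribution $\mathcal D$ on $[B]$, if $x_1,\dots,x_n$ are drawn independently from $\mathcal D$, then its output $\tilde m$ is an $\alpha$-approximate $q$-quantile of $\mathcal D$ with probability at least $\frac12$. Then $$n\ \ge\ c\cdot\frac{\log B}{\varepsilon^2\alpha^2}.$$ -/

import Mathlib

open MeasureTheory ProbabilityTheory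
open scoped ENNReal

namespace LDPQuantile

/-- The ordered data domain `[B] = {1, …, B}`. -/
abbrev Data (B : ℕ) : Type := Set.Icc 1 B

/-- The possible estimates `{0, 1, …, B}`. The value `0` is admitted because of distributions that
have at least `q + α` of their mass at the point `1`: for these no `m ∈ [B]` satisfies
`IsApproxQuantile` below, whereas `m = 0` does. Protocols with estimates in `[B]` are included. -/
abbrev Estimate (B : ℕ) : Type := Set.Icc 0 B

/-- The cumulative distribution function `F(t) = Pr_{x ∼ D}[x ≤ t]`. In particular `F 0 = 0`, and
`F t = 1` for `B ≤ t`. -/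
noncomputable def distCDF {B : ℕ} (D : Measure (Data B)) (t : ℕ) : ℝ :=
  D.real {x | (x : ℕ) ≤ t}

/-- `m` is an `α`-approximate `q`-quantile of `D`. -/
def IsApproxQuantile {B : ℕ} (D : Measure (Data B)) (q α : ℝ) (m : ℕ) : Prop :=
  (Set.Icc (distCDF D m) (distCDF D (m + 1)) ∩ Set.Ioo (q - α) (q + α)).Nonempty

/-- A sequentially interactive protocol with `n` users, data in `[B]`, and messages in an arbitrary
measurable space `Y`. User `i` reports a random message `yᵢ = Mᵢ(xᵢ, y₁, …, yᵢ₋₁)`, and the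
aggregator computes an estimate from all the messages. -/
structure Protocol (B n : ℕ) (Y : Type*) [MeasurableSpace Y] where
  /-- `mech i (x, h)` is the law of the message of user `i` with datum `x`, given the earlier
  messages `h`. -/
  mech : (i : Fin n) → Kernel (Data B × (Fin i → Y)) Y
  isMarkov : ∀ i, IsMarkovKernel (mech i)
  estimate : (Fin n → Y) → Estimate B
  measurable_estimate : Measurable estimate

namespace Protocol

variable {B n : ℕ} {Y : Type*} [MeasurableSpace Y]

/-- `ε`-local differential privacy: for any fixed earlier messages `h`, each mechanism is
`ε`-differentially private in the datum of its user. -/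
def IsLDP (M : Protocol B n Y) (ε : ℝ) : Prop :=
  ∀ (i : Fin n) (h : Fin i → Y) (x x' : Data B) (S : Set Y), MeasurableSet S →
    M.mech i (x, h) S ≤ ENNReal.ofReal (Real.exp ε) * M.mech i (x', h) S

/-- The joint law of the first `k` messages when the data of the users are independent samples
from `D`: given the messages `h` of the first `k` users, the next user draws a fresh `x ∼ D` and
appends a message `y ∼ mech k (x, h)`. -/
noncomputable def transcriptLaw (M : Protocol B n Y) (D : Measure (Data B)) :
    (k : ℕ) → k ≤ n → Measure (Fin k → Y)
  | 0, _ => Measure.dirac (fun i => i.elim0)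
  | k + 1, hk => (M.transcriptLaw D k (Nat.le_of_succ_le hk)).bind fun h =>
      D.bind fun x => (M.mech ⟨k, hk⟩ (x, h)).map fun y => (Fin.snoc h y : Fin (k + 1) → Y)

/-- The protocol solves the statistical `q`-quantile problem for `D` with accuracy `α` and
probability at least `p`. -/
def SolvesStatQuantile (M : Protocol B n Y) (D : Measure (Data B)) (α q : ℝ) (p : ℝ≥0∞) : Prop :=
  p ≤ M.transcriptLaw D n le_rfl {y | IsApproxQuantile D q α (M.estimate y)}

end Protocol

end LDPQuantile

namespace LDPQuantile

/-! ### Chi-square calculus in dual form. -/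

section SecondMoment

/-! Put mass `q - α` at `1`, `2α` at `j` and `1 - q - α` at `B`. The only accurate answer is then `j
- 1` (`IsApproxQuantile.succ_eq`), so the `B` choices of `j` demand different outputs. Compare with
the instance `j = B`, whose transcript law is `Q`: by pigeonhole some output `j - 1` has
`Q`-probability at most `1/B`, though it has probability at least `1/2` under the law `P` of
instance `j`.

Moving an atom of mass `2α` perturbs one private message only slightly: by
`SecondMomentBound.of_perturbation` its `1 + χ²` is at most `1 + s²` with `s = 2α e^ε (e^ε - 1) =
O(αε)`. These factors multiply over the rounds, even with interaction, so `1 + χ²(P ‖ Q) ≤ (1 +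
s²)^n`. Boosting an event from `1/B` to `1/2` forces this to exceed a fixed power of `B`, so `log B
= O(n α² ε²)`. -/

lemma sq_le_sq_of_abs_bound {X : Type*} {f : X → ℝ} {C : ℝ} (hC : ∀ x, |f x| ≤ C) (x : X) :
    |f x ^ 2| ≤ C ^ 2 := by
  rw [abs_pow]
  exact pow_le_pow_left₀ (abs_nonneg _) (hC x) 2

variable {Ω Ω' : Type*} [MeasurableSpace Ω] [MeasurableSpace Ω']

/-- The dual form of `1 + χ²(P ‖ Q) ≤ K`, which needs no densities. -/
def SecondMomentBound (P Q : Measure Ω) (K : ℝ) : Prop :=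
  ∀ f : Ω → ℝ, Measurable f → (∃ C, ∀ x, |f x| ≤ C) → (∫ x, f x ∂P) ^ 2 ≤ K * ∫ x, f x ^ 2 ∂Q

lemma integrable_of_abs_le {P : Measure Ω} [IsFiniteMeasure P] {f : Ω → ℝ} (hf : Measurable f)
    {C : ℝ} (hC : ∀ x, |f x| ≤ C) : Integrable f P :=
  Integrable.of_bound hf.aestronglyMeasurable C (Filter.Eventually.of_forall hC)

lemma abs_integral_le_of_abs_le {P : Measure Ω} [IsProbabilityMeasure P] {f : Ω → ℝ}
    {C : ℝ} (hC : ∀ x, |f x| ≤ C) : |∫ x, f x ∂P| ≤ C := by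
  have := norm_integral_le_of_norm_le_const (μ := P) (f := f) (C := C)
    (Filter.Eventually.of_forall hC)
  simpa using this

lemma integral_bind {P : Measure Ω} [IsProbabilityMeasure P] {κ : Kernel Ω Ω'} [IsMarkovKernel κ]
    {f : Ω' → ℝ} (hf : Integrable f (P.bind κ)) :
    ∫ y, f y ∂P.bind κ = ∫ x, ∫ y, f y ∂κ x ∂P := by
  have e : (κ ∘ₖ Kernel.const Unit P) () = P.bind κ := by
    rw [Kernel.comp_apply, Kernel.const_apply]
  rw [← e] at hf ⊢
  rw [Kernel.integral_comp hf, Kernel.const_apply]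

/-- Second-moment bounds multiply along a Markov kernel. -/
lemma SecondMomentBound.bind {P Q : Measure Ω} [IsProbabilityMeasure P] [IsProbabilityMeasure Q]
    {κ η : Kernel Ω Ω'} [IsMarkovKernel κ] [IsMarkovKernel η] {K L : ℝ} (hK : 0 ≤ K)
    (h : SecondMomentBound P Q K) (hκ : ∀ x, SecondMomentBound (κ x) (η x) L) :
    SecondMomentBound (P.bind κ) (Q.bind η) (K * L) := by
  rintro f hf ⟨C, hC⟩
  have hC2 := sq_le_sq_of_abs_bound hC
  rw [integral_bind (integrable_of_abs_le hf hC),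
    integral_bind (integrable_of_abs_le (hf.pow_const 2) hC2)]
  have hm : Measurable fun x => ∫ y, f y ∂κ x :=
    (hf.stronglyMeasurable.integral_kernel (κ := κ)).measurable
  have hm' : Measurable fun x => ∫ y, f y ^ 2 ∂η x :=
    ((hf.pow_const 2).stronglyMeasurable.integral_kernel (κ := η)).measurable
  have hb : ∀ x, |∫ y, f y ∂κ x| ≤ C := fun x => abs_integral_le_of_abs_le hC
  have hb' : ∀ x, |∫ y, f y ^ 2 ∂η x| ≤ C ^ 2 := fun x => abs_integral_le_of_abs_le hC2
  -- The outer bound is tested on the conditional mean under `κ`; then `hκ` applies pointwise.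
  refine (h _ hm ⟨C, hb⟩).trans ?_
  rw [mul_assoc, ← integral_const_mul L]
  refine mul_le_mul_of_nonneg_left (integral_mono ?_ ?_ fun x => hκ x f hf ⟨C, hC⟩) hK
  · exact integrable_of_abs_le (hm.pow_const 2) (sq_le_sq_of_abs_bound hb)
  · exact (integrable_of_abs_le hm' hb').const_mul L

lemma integral_le_mul_of_le_smul {μ ν : Measure Ω} [IsFiniteMeasure ν] {c : ℝ} (hc : 0 ≤ c)
    (h : μ ≤ ENNReal.ofReal c • ν) {f : Ω → ℝ} (hf : Integrable f ν) (h0 : ∀ x, 0 ≤ f x) :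
    ∫ x, f x ∂μ ≤ c * ∫ x, f x ∂ν := by
  have := integral_mono_measure h (Filter.Eventually.of_forall h0)
    (hf.smul_measure ENNReal.ofReal_ne_top)
  rwa [integral_smul_measure, ENNReal.toReal_ofReal hc, smul_eq_mul] at this

/-- Integrals against two measures with likelihood ratios in `[c⁻¹, c]` are close. -/
lemma abs_integral_sub_le_of_le_smul {μ ν : Measure Ω} [IsFiniteMeasure μ] [IsFiniteMeasure ν]
    {c : ℝ} (hc : 1 ≤ c) (hμν : μ ≤ ENNReal.ofReal c • ν) (hνμ : ν ≤ ENNReal.ofReal c • μ)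
    {f : Ω → ℝ} (hμ : Integrable f μ) (hν : Integrable f ν) :
    |∫ x, f x ∂μ - ∫ x, f x ∂ν| ≤ (c - 1) * ∫ x, |f x| ∂ν := by
  have key : ∀ g : Ω → ℝ, Integrable g μ → Integrable g ν →
      ∫ x, g x ∂μ - ∫ x, g x ∂ν ≤ (c - 1) * ∫ x, |g x| ∂ν := by
    intro g hgμ hgν
    have h1 := integral_le_mul_of_le_smul (by linarith) hμν hgν.pos_part (fun x => le_max_right _ _)
    have h2 := integral_le_mul_of_le_smul (by linarith) hνμ hgμ.neg_part (fun x => le_max_right _ _)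
    have e : ∀ x, g x = max (g x) 0 - max (-g x) 0 := fun x => by
      rcases le_total (g x) 0 with h | h <;> simp [h]
    have e' : ∀ x, |g x| = max (g x) 0 + max (-g x) 0 := fun x => by
      rcases le_total (g x) 0 with h | h <;> simp [h, abs_of_nonneg, abs_of_nonpos]
    have i1 : ∫ x, g x ∂μ = ∫ x, max (g x) 0 ∂μ - ∫ x, max (-g x) 0 ∂μ := by
      rw [← integral_sub hgμ.pos_part hgμ.neg_part]
      exact integral_congr_ae (Filter.Eventually.of_forall e)
    have i2 : ∫ x, g x ∂ν = ∫ x, max (g x) 0 ∂ν - ∫ x, max (-g x) 0 ∂ν := by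
      rw [← integral_sub hgν.pos_part hgν.neg_part]
      exact integral_congr_ae (Filter.Eventually.of_forall e)
    have i3 : ∫ x, |g x| ∂ν = ∫ x, max (g x) 0 ∂ν + ∫ x, max (-g x) 0 ∂ν := by
      rw [← integral_add hgν.pos_part hgν.neg_part]
      exact integral_congr_ae (Filter.Eventually.of_forall e')
    have n1 : 0 ≤ ∫ x, max (-g x) 0 ∂ν := integral_nonneg fun x => le_max_right _ _
    have n2 : 0 ≤ ∫ x, max (-g x) 0 ∂μ := integral_nonneg fun x => le_max_right _ _
    rw [i1, i2, i3]
    nlinarith [mul_nonneg (sub_nonneg.2 hc) (sub_nonneg.2 h2),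
      mul_nonneg (mul_nonneg (sub_nonneg.2 hc) (sub_nonneg.2 hc)) n2]
  rw [abs_le]
  constructor
  · have := key (fun x => -f x) hμ.neg hν.neg
    simp only [integral_neg, abs_neg] at this
    linarith
  · exact key f hμ hν

/-- If `P = Q + t (μ - ν)` with `μ`, `ν`, `Q` mutually close, then `P` and `Q` are close to second
order. -/
lemma SecondMomentBound.of_perturbation {P Q μ ν : Measure Ω} [IsProbabilityMeasure P]
    [IsProbabilityMeasure Q] [IsProbabilityMeasure μ] [IsProbabilityMeasure ν] {c t : ℝ}
    (hc : 1 ≤ c) (ht : 0 ≤ t) (hμν : μ ≤ ENNReal.ofReal c • ν) (hνμ : ν ≤ ENNReal.ofReal c • μ)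
    (hνQ : ν ≤ ENNReal.ofReal c • Q)
    (hP : ∀ f : Ω → ℝ, Measurable f → (∃ C, ∀ x, |f x| ≤ C) →
      ∫ x, f x ∂P = ∫ x, f x ∂Q + t * (∫ x, f x ∂μ - ∫ x, f x ∂ν)) :
    SecondMomentBound P Q (1 + (t * (c * (c - 1))) ^ 2) := by
  rintro f hf ⟨C, hC⟩
  set a := ∫ x, f x ∂Q with ha
  set s := t * (c * (c - 1))
  have hs : 0 ≤ s := mul_nonneg ht (mul_nonneg (by linarith) (by linarith))
  have hg : Measurable fun x => f x - a := hf.sub_const a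
  have hgC : ∀ x, |f x - a| ≤ C + |a| := fun x =>
    (abs_sub _ _).trans (by linarith [hC x])
  have hg' : Measurable fun x => |f x - a| := hg.abs
  have hgC' : ∀ x, |(|f x - a|)| ≤ C + |a| := fun x => by rw [abs_abs]; exact hgC x
  have hfi : ∀ (R : Measure Ω) [IsProbabilityMeasure R], Integrable f R :=
    fun R _ => integrable_of_abs_le hf hC
  have h1 : |∫ x, (f x - a) ∂μ - ∫ x, (f x - a) ∂ν| ≤ (c - 1) * ∫ x, |f x - a| ∂ν :=
    abs_integral_sub_le_of_le_smul hc hμν hνμ (integrable_of_abs_le hg hgC)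
      (integrable_of_abs_le hg hgC)
  have h2 : ∫ x, |f x - a| ∂ν ≤ c * ∫ x, |f x - a| ∂Q :=
    integral_le_mul_of_le_smul (by linarith) hνQ (integrable_of_abs_le hg' hgC')
      fun x => abs_nonneg _
  -- Centring is free since `μ` and `ν` have equal mass; it makes the error scale with the deviation
  -- of `f`.
  have h3 : ∫ x, (f x - a) ∂μ - ∫ x, (f x - a) ∂ν = ∫ x, f x ∂μ - ∫ x, f x ∂ν := by
    rw [integral_sub (hfi μ) (integrable_const a), integral_sub (hfi ν) (integrable_const a)]
    simp
  set b := ∫ x, |f x - a| ∂Q with hb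
  have hb0 : 0 ≤ b := integral_nonneg fun x => abs_nonneg _
  have hvar : b ^ 2 ≤ ∫ x, f x ^ 2 ∂Q - a ^ 2 := by
    have i1 : Integrable (fun x => f x ^ 2) Q :=
      integrable_of_abs_le (hf.pow_const 2) (sq_le_sq_of_abs_bound hC)
    have i2 : Integrable (fun x => |f x - a|) Q := integrable_of_abs_le hg' hgC'
    have i12 : Integrable (fun x => f x ^ 2 - 2 * a * f x) Q := i1.sub ((hfi Q).const_mul _)
    have i123 : Integrable (fun x => f x ^ 2 - 2 * a * f x - 2 * b * |f x - a|) Q :=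
      i12.sub (i2.const_mul _)
    have e : ∫ x, (|f x - a| - b) ^ 2 ∂Q = ∫ x, f x ^ 2 ∂Q - a ^ 2 - b ^ 2 := by
      have : ∀ x, (|f x - a| - b) ^ 2
          = f x ^ 2 - 2 * a * f x - 2 * b * |f x - a| + (a ^ 2 + b ^ 2) := fun x => by
        rw [sub_sq, sq_abs]; ring
      simp_rw [this]
      rw [integral_add i123 (integrable_const _),
        integral_sub i12 (i2.const_mul _),
        integral_sub i1 ((hfi Q).const_mul _), integral_const_mul, integral_const_mul, ← ha, ← hb]
      simp
      ring
    have : 0 ≤ ∫ x, (|f x - a| - b) ^ 2 ∂Q := integral_nonneg fun x => sq_nonneg _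
    linarith
  have hd : |t * (∫ x, f x ∂μ - ∫ x, f x ∂ν)| ≤ s * b := by
    rw [abs_mul, abs_of_nonneg ht, ← h3]
    calc _ ≤ t * ((c - 1) * (c * b)) := by
          gcongr
          exact h1.trans (mul_le_mul_of_nonneg_left h2 (by linarith))
      _ = s * b := by simp only [s]; ring
  rw [hP f hf ⟨C, hC⟩]
  set d := t * (∫ x, f x ∂μ - ∫ x, f x ∂ν)
  calc (a + d) ^ 2 ≤ (|a| + s * b) ^ 2 := by
        refine sq_le_sq' ?_ ?_
        · linarith [neg_abs_le a, neg_abs_le d]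
        · linarith [le_abs_self a, le_abs_self d]
    -- Cauchy–Schwarz for `(1, s)` and `(|a|, b)`.
    _ ≤ (1 + s ^ 2) * (a ^ 2 + b ^ 2) := by
        nlinarith [sq_nonneg (s * |a| - b), sq_abs a]
    _ ≤ _ := mul_le_mul_of_nonneg_left (by linarith) (by positivity)

/-- An event of probability at least `1/2` under `P` cannot be too rare under `Q`. -/
lemma SecondMomentBound.one_le {P Q : Measure Ω} [IsProbabilityMeasure P] [IsProbabilityMeasure Q]
    {K : ℝ} (h : SecondMomentBound P Q K) {A : Set Ω} (hA : MeasurableSet A)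
    (hP : 1 / 2 ≤ P.real A) (hQ : Q.real A ≤ 1 / 2) :
    1 ≤ 4 * K * (Q.real A * (1 - Q.real A)) := by
  set r := Q.real A with hr
  have hr0 : 0 ≤ r := measureReal_nonneg
  have hint : ∀ (ρ : Measure Ω) [IsProbabilityMeasure ρ] (u v : ℝ),
      ∫ x, (v + A.indicator (fun _ : Ω => u) x) ∂ρ = v + u * ρ.real A := by
    intro ρ _ u v
    rw [integral_add (integrable_const _) ((integrable_const u).indicator hA),
      integral_indicator_const _ hA]
    simp [mul_comm]
  have hsq : ∀ x, (r + A.indicator (fun _ => 1 - 2 * r) x) ^ 2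
      = r ^ 2 + A.indicator (fun _ => (1 - r) ^ 2 - r ^ 2) x := fun x => by
    by_cases hx : x ∈ A <;> simp [hx]
    ring
  -- The test function is `1 - r` on `A` and `r` off it, proportional to the likelihood ratio in the
  -- extremal case `P A = 1/2`. The plain indicator would lose the factor `1 - r`, and with it all
  -- information at `B = 4`.
  have := h (fun x => r + A.indicator (fun _ => 1 - 2 * r) x)
    ((measurable_const.indicator hA).const_add r) ⟨1, fun x => by
      by_cases hx : x ∈ A <;> simp only [hx, Set.indicator_of_mem, Set.indicator_of_notMem,
        not_false_eq_true] <;> rw [abs_le] <;> constructor <;> linarith⟩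
  simp_rw [hsq] at this
  rw [hint, hint, ← hr] at this
  have h2 : (1 / 2 : ℝ) ≤ r + (1 - 2 * r) * P.real A := by nlinarith
  have h3 : (1 / 2 : ℝ) ^ 2 ≤ (r + (1 - 2 * r) * P.real A) ^ 2 :=
    pow_le_pow_left₀ (by norm_num) h2 2
  nlinarith

end SecondMoment

section HardInstances

variable {B : ℕ}

/-- Mass `u`, `v`, `w` at the points `x`, `y`, `z`. -/
noncomputable def threePoint {X : Type*} [MeasurableSpace X] (u v w : ℝ) (x y z : X) : Measure X :=
  ENNReal.ofReal u • Measure.dirac x + ENNReal.ofReal v • Measure.dirac y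
    + ENNReal.ofReal w • Measure.dirac z

lemma isProbabilityMeasure_threePoint {X : Type*} [MeasurableSpace X] {u v w : ℝ} (hu : 0 ≤ u)
    (hv : 0 ≤ v) (hw : 0 ≤ w) (h : u + v + w = 1) (x y z : X) :
    IsProbabilityMeasure (threePoint u v w x y z) := by
  constructor
  simp only [threePoint, Measure.add_apply, Measure.smul_apply, measure_univ, smul_eq_mul, mul_one]
  rw [← ENNReal.ofReal_add hu hv, ← ENNReal.ofReal_add (by positivity) hw, h, ENNReal.ofReal_one]

lemma distCDF_threePoint {u v w : ℝ} (hu : 0 ≤ u) (hv : 0 ≤ v) (hw : 0 ≤ w)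
    (x y z : Data B) (t : ℕ) :
    distCDF (threePoint u v w x y z) t = (if (x : ℕ) ≤ t then u else 0)
      + (if (y : ℕ) ≤ t then v else 0) + (if (z : ℕ) ≤ t then w else 0) := by
  have hs : MeasurableSet {a : Data B | (a : ℕ) ≤ t} := MeasurableSet.of_discrete
  have e : ∀ (r : ℝ) (p : Data B), 0 ≤ r →
      (ENNReal.ofReal r • Measure.dirac p).real {a : Data B | (a : ℕ) ≤ t}
        = if (p : ℕ) ≤ t then r else 0 := by
    intro r p hr
    rw [measureReal_ennreal_smul_apply, ENNReal.toReal_ofReal hr, measureReal_def,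
      Measure.dirac_apply' _ hs]
    by_cases hp : (p : ℕ) ≤ t <;> simp [hp]
  have hfin : ∀ (r : ℝ) (p : Data B), IsFiniteMeasure (ENNReal.ofReal r • Measure.dirac p) :=
    fun r p => Measure.smul_finite _ ENNReal.ofReal_ne_top
  rw [distCDF, threePoint, measureReal_add_apply, measureReal_add_apply, e u x hu, e v y hv,
    e w z hw]

/-- The point just below the middle atom is the only accurate answer. -/
lemma IsApproxQuantile.succ_eq {q α : ℝ} (hα : 0 ≤ α) (h1 : α ≤ q) (h2 : q + α ≤ 1)
    {x y z : Data B} (hxy : x ≤ y) (hyz : y ≤ z) {m : ℕ}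
    (h : IsApproxQuantile (threePoint (q - α) (2 * α) (1 - q - α) x y z) q α m) :
    m + 1 = y := by
  obtain ⟨a, ⟨ha1, ha2⟩, ha3, ha4⟩ := h
  rw [distCDF_threePoint (by linarith) (mul_nonneg zero_le_two hα) (by linarith)] at ha1 ha2
  have hxy' : (x : ℕ) ≤ y := hxy
  have hyz' : (y : ℕ) ≤ z := hyz
  by_contra hne
  rcases Nat.lt_or_gt_of_ne hne with hlt | hgt
  -- Left of the atom `F (m + 1) ≤ q - α`; otherwise `F m ≥ q + α`. The open window excludes both.
  · rw [if_neg (by omega : ¬ (y : ℕ) ≤ m + 1), if_neg (by omega : ¬ (z : ℕ) ≤ m + 1)] at ha2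
    split_ifs at ha2 <;> linarith
  · rw [if_pos (by omega : (x : ℕ) ≤ m), if_pos (by omega : (y : ℕ) ≤ m)] at ha1
    split_ifs at ha1 <;> linarith

end HardInstances

/-! ### Transcripts of private protocols. -/

namespace Protocol

variable {B n : ℕ} {Y : Type*} [MeasurableSpace Y]

lemma measurable_snoc (k : ℕ) :
    Measurable fun p : (Fin k → Y) × Y => (Fin.snoc p.1 p.2 : Fin (k + 1) → Y) := by
  refine measurable_pi_lambda _ fun i => ?_
  refine Fin.lastCases ?_ (fun j => ?_) i
  · simpa using measurable_snd
  · simpa [Function.comp_def] using (measurable_pi_apply j).comp measurable_fst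

/-- The law of the transcript after user `k`, given the datum and the earlier messages. -/
noncomputable def extend (M : Protocol B n Y) (k : ℕ) (hk : k < n) :
    Kernel (Data B × (Fin k → Y)) (Fin (k + 1) → Y) :=
  (Kernel.id ×ₖ M.mech ⟨k, hk⟩).map fun p => Fin.snoc p.1.2 p.2

lemma measurable_snoc_snd (k : ℕ) : Measurable
    fun p : (Data B × (Fin k → Y)) × Y => (Fin.snoc p.1.2 p.2 : Fin (k + 1) → Y) :=
  (measurable_snoc k).comp ((measurable_snd.comp measurable_fst).prodMk measurable_snd)

instance (M : Protocol B n Y) (k : ℕ) (hk : k < n) : IsMarkovKernel (M.extend k hk) := by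
  have := M.isMarkov ⟨k, hk⟩
  exact Kernel.IsMarkovKernel.map _ (measurable_snoc_snd k)

lemma extend_apply (M : Protocol B n Y) (k : ℕ) (hk : k < n) (x : Data B) (h : Fin k → Y) :
    M.extend k hk (x, h)
      = (M.mech ⟨k, hk⟩ (x, h)).map fun y => (Fin.snoc h y : Fin (k + 1) → Y) := by
  have := M.isMarkov ⟨k, hk⟩
  rw [extend, Kernel.map_apply _ (measurable_snoc_snd k), Kernel.prod_apply, Kernel.id_apply,
    Measure.dirac_prod, Measure.map_map (measurable_snoc_snd k) (by fun_prop)]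
  rfl

/-- The law of the transcript after user `k`, given the earlier messages, for a datum drawn from
`D`. -/
noncomputable def step (M : Protocol B n Y) (D : Measure (Data B)) [IsProbabilityMeasure D] (k : ℕ)
    (hk : k < n) : Kernel (Fin k → Y) (Fin (k + 1) → Y) where
  toFun h := D.bind fun x => M.extend k hk (x, h)
  measurable' := by
    refine Measure.measurable_of_measurable_coe _ fun s hs => ?_
    have : ∀ h, (D.bind fun x => M.extend k hk (x, h)) s = ∫⁻ x, M.extend k hk (x, h) s ∂D :=
      fun h => Measure.bind_apply hs (Measurable.of_discrete).aemeasurable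
    simp_rw [this]
    exact ((M.extend k hk).measurable_coe hs).lintegral_prod_left'

instance (M : Protocol B n Y) (D : Measure (Data B)) [IsProbabilityMeasure D] (k : ℕ)
    (hk : k < n) : IsMarkovKernel (M.step D k hk) :=
  ⟨fun _ => ⟨by
    change (D.bind _) Set.univ = 1
    rw [Measure.bind_apply .univ (Measurable.of_discrete).aemeasurable]
    simp⟩⟩

/-- Presents a round as a Markov kernel, as `SecondMomentBound.bind` requires. -/
lemma transcriptLaw_succ (M : Protocol B n Y) (D : Measure (Data B)) [IsProbabilityMeasure D]
    (k : ℕ) (hk : k + 1 ≤ n) :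
    M.transcriptLaw D (k + 1) hk
      = (M.transcriptLaw D k (Nat.le_of_succ_le hk)).bind (M.step D k hk) := by
  rw [transcriptLaw]
  congr 1
  ext1 h
  change _ = D.bind fun x => M.extend k hk (x, h)
  simp_rw [extend_apply]

instance isProbabilityMeasure_transcriptLaw (M : Protocol B n Y) (D : Measure (Data B))
    [IsProbabilityMeasure D] : ∀ (k : ℕ) (hk : k ≤ n), IsProbabilityMeasure (M.transcriptLaw D k hk)
  | 0, _ => by rw [transcriptLaw]; infer_instance
  | k + 1, hk => by
    have := isProbabilityMeasure_transcriptLaw M D k (Nat.le_of_succ_le hk)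
    rw [transcriptLaw_succ]
    infer_instance

lemma IsLDP.extend_le {M : Protocol B n Y} {ε : ℝ} (hM : M.IsLDP ε) (k : ℕ) (hk : k < n)
    (x x' : Data B) (h : Fin k → Y) :
    M.extend k hk (x, h) ≤ ENNReal.ofReal (Real.exp ε) • M.extend k hk (x', h) := by
  have hs : Measurable fun y => (Fin.snoc h y : Fin (k + 1) → Y) :=
    (measurable_snoc k).comp measurable_prodMk_left
  refine Measure.le_iff.2 fun s hm => ?_
  rw [extend_apply, extend_apply, Measure.smul_apply, Measure.map_apply hs hm,
    Measure.map_apply hs hm]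
  exact hM ⟨k, hk⟩ h x x' _ (hs hm)

lemma step_threePoint (M : Protocol B n Y) (u v w : ℝ) (x y z : Data B)
    [IsProbabilityMeasure (threePoint u v w x y z)] (k : ℕ) (hk : k < n) (h : Fin k → Y) :
    M.step (threePoint u v w x y z) k hk h = ENNReal.ofReal u • M.extend k hk (x, h)
      + ENNReal.ofReal v • M.extend k hk (y, h) + ENNReal.ofReal w • M.extend k hk (z, h) := by
  ext s hs
  change ((threePoint u v w x y z).bind fun x => M.extend k hk (x, h)) s = _
  rw [Measure.bind_apply hs (Measurable.of_discrete).aemeasurable]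
  simp [threePoint, lintegral_add_measure, lintegral_smul_measure]

lemma integral_step_threePoint (M : Protocol B n Y) {u v w : ℝ} (hu : 0 ≤ u) (hv : 0 ≤ v)
    (hw : 0 ≤ w) (x y z : Data B) [IsProbabilityMeasure (threePoint u v w x y z)]
    (k : ℕ) (hk : k < n) (h : Fin k → Y) {f : (Fin (k + 1) → Y) → ℝ} (hf : Measurable f)
    {C : ℝ} (hC : ∀ a, |f a| ≤ C) :
    ∫ a, f a ∂M.step (threePoint u v w x y z) k hk h = u * ∫ a, f a ∂M.extend k hk (x, h)
      + v * ∫ a, f a ∂M.extend k hk (y, h) + w * ∫ a, f a ∂M.extend k hk (z, h) := by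
  have hi : ∀ (r : ℝ) (p : Data B),
      Integrable f (ENNReal.ofReal r • M.extend k hk (p, h)) := fun r p =>
    (integrable_of_abs_le hf hC).smul_measure ENNReal.ofReal_ne_top
  rw [step_threePoint, integral_add_measure ((hi u x).add_measure (hi v y)) (hi w z),
    integral_add_measure (hi u x) (hi v y)]
  simp only [integral_smul_measure, ENNReal.toReal_ofReal, hu, hv, hw, smul_eq_mul]

/-- Moving the middle atom of the data distribution changes the transcript of a private protocol
only to second order. -/
lemma IsLDP.secondMomentBound {M : Protocol B n Y} {ε : ℝ} (hM : M.IsLDP ε) (hε : 0 ≤ ε)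
    {u v w : ℝ} (hu : 0 ≤ u) (hv : 0 ≤ v) (hw : 0 ≤ w) (h1 : u + v + w = 1) (x y y' z : Data B)
    [IsProbabilityMeasure (threePoint u v w x y z)]
    [IsProbabilityMeasure (threePoint u v w x y' z)] : ∀ (k : ℕ) (hk : k ≤ n),
    SecondMomentBound (M.transcriptLaw (threePoint u v w x y z) k hk)
      (M.transcriptLaw (threePoint u v w x y' z) k hk)
      ((1 + (v * (Real.exp ε * (Real.exp ε - 1))) ^ 2) ^ k)
  | 0, _ => by
    intro f hf _
    rw [transcriptLaw, transcriptLaw, integral_dirac' _ _ hf.stronglyMeasurable,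
      integral_dirac' _ _ (hf.pow_const 2).stronglyMeasurable]
    simp
  | k + 1, hk => by
    rw [transcriptLaw_succ, transcriptLaw_succ, pow_succ]
    refine SecondMomentBound.bind (by positivity)
      (IsLDP.secondMomentBound hM hε hu hv hw h1 x y y' z k _) fun h => ?_
    refine SecondMomentBound.of_perturbation (μ := M.extend k hk (y, h))
      (ν := M.extend k hk (y', h)) (Real.one_le_exp hε) hv (hM.extend_le k hk _ _ h)
      (hM.extend_le k hk _ _ h) ?_ ?_
    -- Splitting the measure with the weights of the mixture allows a termwise privacy comparison.
    · have e : M.extend k hk (y', h) = ENNReal.ofReal u • M.extend k hk (y', h)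
          + ENNReal.ofReal v • M.extend k hk (y', h)
          + ENNReal.ofReal w • M.extend k hk (y', h) := by
        rw [← add_smul, ← add_smul, ← ENNReal.ofReal_add hu hv,
          ← ENNReal.ofReal_add (by positivity) hw, h1, ENNReal.ofReal_one, one_smul]
      rw [step_threePoint]
      refine Measure.le_iff.2 fun s hs => ?_
      have hp : ∀ p, M.extend k hk (y', h) s
          ≤ ENNReal.ofReal (Real.exp ε) * M.extend k hk (p, h) s := fun p =>
        hM.extend_le k hk y' p h s
      conv_lhs => rw [e]
      simp only [Measure.add_apply, Measure.smul_apply, smul_eq_mul, mul_add]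
      gcongr ?_ + ?_ + ?_ <;> rw [mul_left_comm] <;> exact mul_le_mul_right (hp _) _
    · rintro f hf ⟨C, hC⟩
      rw [integral_step_threePoint M hu hv hw x y z k hk h hf hC,
        integral_step_threePoint M hu hv hw x y' z k hk h hf hC]
      ring

end Protocol

/-! ### Numerical estimates and pigeonhole. -/

lemma exp_mul_exp_sub_one_le {ε : ℝ} (h0 : 0 ≤ ε) (h1 : ε ≤ 1) :
    Real.exp ε * (Real.exp ε - 1) ≤ 5 * ε := by
  have hle : Real.exp ε ≤ 2.72 :=
    (Real.exp_le_exp.2 h1).trans (by linarith [Real.exp_one_lt_d9])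
  -- The chord of `exp` over `[0, 1]`; then `2.72 * 1.72 < 5`.
  have hc := convexOn_exp.2 (Set.mem_univ 0) (Set.mem_univ 1) (sub_nonneg.2 h1) h0 (by ring)
  simp only [smul_eq_mul, mul_zero, mul_one, zero_add, Real.exp_zero] at hc
  have hs : Real.exp ε - 1 ≤ 1.72 * ε := by nlinarith [Real.exp_one_lt_d9]
  nlinarith [Real.one_le_exp h0]

/-- If `1 ≤ 4 K r (1 - r)` with `r ≤ 1 / b` then `K` is at least a small power of `b`. -/
lemma le_pow_of_one_le_mul {b K r : ℝ} (hb : 4 ≤ b) (hr : r ≤ 1 / b) (hK : 0 ≤ K)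
    (h : 1 ≤ 4 * K * (r * (1 - r))) : b ≤ K ^ 16 := by
  have hb0 : 0 < b := by linarith
  have hr4 : 1 / b ≤ 1 / 4 := one_div_le_one_div_of_le (by norm_num) hb
  have h1 : r * (1 - r) ≤ 1 / b * (1 - 1 / b) := by nlinarith
  have h2 : 1 / b * (1 - 1 / b) = (b - 1) / b ^ 2 := by field_simp
  have h3 : 1 ≤ 4 * K * ((b - 1) / b ^ 2) :=
    h.trans (by rw [← h2]; exact mul_le_mul_of_nonneg_left h1 (by positivity))
  have h4 : b ^ 2 ≤ 4 * K * (b - 1) := by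
    rwa [← mul_div_assoc, le_div_iff₀ (by positivity), one_mul] at h3
  have h5 : (b - 1) / 16 ≤ K - 1 := by
    have : 0 ≤ (b - 1) * (4 * (K - 1) - (b - 1) / 4) := by nlinarith
    have := nonneg_of_mul_nonneg_right this (by linarith)
    linarith
  -- Bernoulli; the exponent 16 cancels the denominator in `h5`.
  have h6 := one_add_mul_le_pow (a := K - 1) (by linarith) 16
  rw [add_sub_cancel] at h6
  push_cast at h6
  linarith

/-- Some estimate is produced with probability at most `1 / B`. -/
lemma exists_measureReal_le_one_div {B : ℕ} (hB : 0 < B) {Ω : Type*} [MeasurableSpace Ω]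
    (Q : Measure Ω) [IsProbabilityMeasure Q] {g : Ω → Estimate B} (hg : Measurable g) :
    ∃ j : Data B, Q.real {y | (g y : ℕ) + 1 = j} ≤ 1 / B := by
  have hm : ∀ j : Data B, MeasurableSet {y | (g y : ℕ) + 1 = j} := fun j =>
    hg (MeasurableSet.of_discrete (s := {e : Estimate B | (e : ℕ) + 1 = j}))
  have hne : (Finset.univ : Finset (Data B)).Nonempty := ⟨⟨1, le_rfl, hB⟩, Finset.mem_univ _⟩
  obtain ⟨j, -, hj⟩ := Finset.exists_le_of_sum_le (s := Finset.univ)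
    (f := fun j : Data B => Q.real {y | (g y : ℕ) + 1 = j}) (g := fun _ => (1 / B : ℝ)) hne (by
      rw [← measureReal_biUnion_finset (fun i _ j _ hij => ?_) fun j _ => hm j]
      · refine measureReal_le_one.trans (le_of_eq ?_)
        have : (B : ℝ) ≠ 0 := by positivity
        simp [this]
      · refine Set.disjoint_left.2 fun y hi hj => hij (Subtype.ext ?_)
        exact (Eq.symm hi).trans hj)
  exact ⟨j, hj⟩

end LDPQuantile

open LDPQuantile in
theorem mainTheorem7 :
    ∃ c : ℝ, 0 < c ∧
      ∀ (B n : ℕ) (α ε q : ℝ), 4 ≤ B → 0 < α → α < 1 / 2 → 0 < ε → ε < 1 →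
        q ∈ Set.Ioo (2 * α) (1 - 2 * α) →
        ∀ (Y : Type*) [MeasurableSpace Y] (M : LDPQuantile.Protocol B n Y),
          M.IsLDP ε →
          (∀ D : MeasureTheory.Measure (LDPQuantile.Data B),
            MeasureTheory.IsProbabilityMeasure D → M.SolvesStatQuantile D α q (1 / 2)) →
          c * (Real.log B / (ε ^ 2 * α ^ 2)) ≤ n := by
  -- `1600 = 16 * 100`: the exponent in `hpow` times the constant in `hs`.
  refine ⟨1 / 1600, by norm_num, ?_⟩
  rintro B n α ε q hB hα - hε hε1 ⟨hq1, hq2⟩ Y _ M hM hsolve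
  have hu : 0 ≤ q - α := by linarith
  have hv : 0 ≤ 2 * α := by linarith
  have hw : 0 ≤ 1 - q - α := by linarith
  have h1 : (q - α) + 2 * α + (1 - q - α) = 1 := by ring
  let lo : Data B := ⟨1, le_rfl, by omega⟩
  let hi : Data B := ⟨B, by omega, le_rfl⟩
  have hprob : ∀ j, IsProbabilityMeasure (threePoint (q - α) (2 * α) (1 - q - α) lo j hi) :=
    fun j => isProbabilityMeasure_threePoint hu hv hw h1 lo j hi
  set Q := M.transcriptLaw (threePoint (q - α) (2 * α) (1 - q - α) lo hi hi) n le_rfl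
  obtain ⟨j, hj⟩ := exists_measureReal_le_one_div (by omega) Q M.measurable_estimate
  set P := M.transcriptLaw (threePoint (q - α) (2 * α) (1 - q - α) lo j hi) n le_rfl
  have hA : MeasurableSet {y | (M.estimate y : ℕ) + 1 = j} :=
    M.measurable_estimate (MeasurableSet.of_discrete (s := {e : Estimate B | (e : ℕ) + 1 = j}))
  have hPA : 1 / 2 ≤ P.real {y | (M.estimate y : ℕ) + 1 = j} := by
    have hle := (hsolve _ (hprob j)).trans (measure_mono (μ := P) fun y hy =>
      IsApproxQuantile.succ_eq hα.le (by linarith) (by linarith) j.2.1 j.2.2 hy)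
    have := ENNReal.toReal_mono (measure_ne_top P _) hle
    rw [measureReal_def]
    refine le_trans (by simp) this
  have hB' : (4 : ℝ) ≤ B := by exact_mod_cast hB
  have hB4 : (1 : ℝ) / B ≤ 1 / 4 := one_div_le_one_div_of_le (by norm_num) hB'
  have hbound := (hM.secondMomentBound hε.le hu hv hw h1 lo j hi hi n le_rfl).one_le hA hPA
    (by linarith)
  have hpow := le_pow_of_one_le_mul hB' hj (by positivity) hbound
  set s := 2 * α * (Real.exp ε * (Real.exp ε - 1))
  have hs0 : 0 ≤ s :=
    mul_nonneg hv (mul_nonneg (Real.exp_nonneg _) (by linarith [Real.one_le_exp hε.le]))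
  have hs : s ^ 2 ≤ 100 * (ε ^ 2 * α ^ 2) := by
    have : s ≤ 2 * α * (5 * ε) := mul_le_mul_of_nonneg_left (exp_mul_exp_sub_one_le hε.le hε1.le) hv
    calc s ^ 2 ≤ (2 * α * (5 * ε)) ^ 2 := pow_le_pow_left₀ hs0 this 2
      _ = _ := by ring
  have hlog : Real.log B ≤ 16 * (n * s ^ 2) := by
    refine (Real.log_le_log (by linarith) hpow).trans ?_
    rw [Real.log_pow, Real.log_pow]
    push_cast
    have := Real.log_le_sub_one_of_pos (show 0 < 1 + s ^ 2 by positivity)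
    gcongr
    linarith
  rw [← mul_div_assoc, div_le_iff₀ (by positivity)]
  have : (n : ℝ) * s ^ 2 ≤ n * (100 * (ε ^ 2 * α ^ 2)) := by gcongr
  linarith
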